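/- Let $\mathcal{A}\subset\mathbb{Z}$ be a finite alphabet and let $G=(V,E)$ be a finite directed graph with $V\neq\emptyset$ (loops and parallel edges allowed), equipped with a labelling $\ell:E\to\mathcal{A}$ of its edges. For $a\in\mathcal{A}$ let $M_a$ be the $V\times V$ matrix whose $(i,j)$ entry is $1$ if there is an edge from $i$ to $j$ with label $a$, and $0$ otherwise. Put $M=\sum_{a\in\mathcal{A}}M_a$ and assume that $M$ is primitive. Let $\lambda>0$ be the Perron–Frobenius eigenvalue of $M$, and let $\mathbf{v}_L,\mathbf{v}_R$ be positive left and right eigenvectors of $M$ for $\lambda$ with $\mathbf{v}_L^{\mathsf T}\mathbf{v}_R=1$. Let $$\mathcal{K}^+=\{(\ell(e_k))_{k\ge1}\mid e_1e_2\ldots\text{ an infinite path in }G\}\subset\mathcal{A}^{\mathbb{N}}$$ be the associated one-sided sofic shift, and let $\mu^+$ be the Borel probability measure on $\mathcal{K}^+$ given on cylinder sets by $$\mu^+([\varepsilon_1,\ldots,\varepsilon_k])=\lambda^{-k}\,\mathbf{v}_L^{\mathsf T}M_{\varepsilon_1}\cdots M_{\varepsilon_k}\mathbf{v}_R .$$ Let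 $\beta>1$ be a Pisot number, i.e. a real algebraic integer all of whose other Galois conjugates have modulus less than $1$ (integers $\ge 2$ included). Define $\phi^+:\mathcal{K}^+\to\mathbb{R}$ by $\phi^+((x_k)_{k\ge1})=\sum_{k=1}^\infty x_k\beta^{-k}$, and let $\nu=\phi^+_*(\mu^+)$ be the push-forward measure. Then the set $\phi^+(\mathcal{K}^+)$ is either finite or perfect (closed without isolated points), and in the latter case it is uncountable. If $\phi^+(\mathcal{K}^+)$ is finite, then $\nu$ is purely atomic, that is, concentrated on its countable set of points of positive mass. If $\phi^+(\mathcal{K}^+)$ is perfect, then $\nu$ is continuous, that is, $\nu(\{x\})=0$ for every $x\in\mathbb{R}$. -/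

import Mathlib

open MeasureTheory

/-- A real number `β` is a Pisot number if `β > 1`, `β` is an algebraic integer, and all Galois
conjugates of `β` other than `β` itself have modulus less than `1`. Integers `≥ 2` are included. -/
def IsPisot (β : ℝ) : Prop :=
  1 < β ∧ IsIntegral ℤ β ∧
    ∀ z : ℂ, Polynomial.aeval z (minpoly ℚ β) = 0 → z ≠ (β : ℂ) → ‖z‖ < 1

/-- A directed graph with vertex set `V` and edge set `E` (loops and parallel edges are allowed),
every edge of which is labelled by a letter of the alphabet `A ⊆ ℤ`. -/
structure LabelledGraph (V E : Type*) (A : Finset ℤ) where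
  /-- initial vertex of an edge -/
  init : E → V
  /-- terminal vertex of an edge -/
  term : E → V
  /-- label of an edge -/
  label : E → A

/-- `lam`, `vL`, `vR` are Perron-Frobenius data of the matrix `M`: a positive eigenvalue with a
positive left eigenvector and a positive right eigenvector, normalised to `vL · vR = 1`. For a
primitive matrix such data exist, the eigenvalue is the dominating one, and the eigenvectors are
unique up to replacing `(vL, vR)` by `(c⁻¹ vL, c vR)`. -/
structure IsPerron {V : Type*} [Fintype V] (M : Matrix V V ℝ) (lam : ℝ) (vL vR : V → ℝ) :
    Prop where
  lam_pos : 0 < lam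
  vL_pos : ∀ i, 0 < vL i
  vR_pos : ∀ i, 0 < vR i
  left_eigen : Matrix.vecMul vL M = lam • vL
  right_eigen : Matrix.mulVec M vR = lam • vR
  normalised : dotProduct vL vR = 1

/-- Existence of a positive eigenvector of a primitive matrix. -/
theorem exists_pos_eigenvector {V : Type*} [Fintype V] [DecidableEq V] [Nonempty V]
    {M : Matrix V V ℝ} (hM : M.IsPrimitive) :
    ∃ (lam : ℝ) (v : V → ℝ), 0 < lam ∧ (∀ i, 0 < v i) ∧ Matrix.mulVec M v = lam • v := by
  classical
  obtain ⟨hnn, k, hk, hB⟩ := hM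
  set B := M ^ k with hBdef
  have hBpos : ∀ x : V → ℝ, 0 ≤ x → x ≠ 0 → ∀ i, 0 < B.mulVec x i := by
    intro x hx hx0 i
    obtain ⟨j, hj⟩ := Function.ne_iff.1 hx0
    refine Finset.sum_pos' (fun l _ => mul_nonneg (hB i l).le (hx l))
      ⟨j, Finset.mem_univ _, mul_pos (hB i j) (lt_of_le_of_ne (hx j) (Ne.symm hj))⟩
  have hcomm : ∀ x, B.mulVec (M.mulVec x) = M.mulVec (B.mulVec x) := by
    intro x
    rw [Matrix.mulVec_mulVec, Matrix.mulVec_mulVec, hBdef, ← pow_succ, ← pow_succ']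
  let f : (V → ℝ) → ℝ := fun x =>
    Finset.univ.inf' Finset.univ_nonempty (fun i => M.mulVec (B.mulVec x) i / B.mulVec x i)
  have hcB : ∀ i, Continuous fun x : V → ℝ => B.mulVec x i := fun i => by
    simp only [Matrix.mulVec, dotProduct]; fun_prop
  have hcM : ∀ i, Continuous fun x : V → ℝ => M.mulVec (B.mulVec x) i := fun i => by
    simp only [Matrix.mulVec, dotProduct]; fun_prop
  have hne0 : ∀ x ∈ stdSimplex ℝ V, x ≠ 0 := by
    rintro x ⟨-, hx⟩ rfl
    simp at hx
  have hcf : ContinuousOn f (stdSimplex ℝ V) := by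
    refine ContinuousOn.finset_inf'_apply _ fun i _ => ?_
    exact (hcM i).continuousOn.div (hcB i).continuousOn
      fun x hx => (hBpos x hx.1 (hne0 x hx) i).ne'
  obtain ⟨x, hx, hmax⟩ := (isCompact_stdSimplex (𝕜 := ℝ) V).exists_isMaxOn
    ⟨_, single_mem_stdSimplex ℝ (Classical.arbitrary V)⟩ hcf
  set y := B.mulVec x with hy
  have hypos : ∀ i, 0 < y i := hBpos x hx.1 (hne0 x hx)
  set r := f x with hr
  have hle : ∀ i, r * y i ≤ M.mulVec y i := fun i => by
    rw [← le_div_iff₀ (hypos i)]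
    exact Finset.inf'_le _ (Finset.mem_univ i)
  have heq : M.mulVec y = r • y := by
    by_contra hne
    have hd : 0 ≤ M.mulVec y - r • y := fun i => by simpa using hle i
    have hd0 : M.mulVec y - r • y ≠ 0 := sub_ne_zero.2 hne
    have h1 := hBpos _ hd hd0
    have hsum : 0 < ∑ i, y i := Finset.sum_pos (fun i _ => hypos i) Finset.univ_nonempty
    set c := (∑ i, y i)⁻¹ with hc
    have hcpos : 0 < c := inv_pos.2 hsum
    have hmem : c • y ∈ stdSimplex ℝ V := by
      refine ⟨fun i => mul_nonneg hcpos.le (hypos i).le, ?_⟩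
      simp only [Pi.smul_apply, smul_eq_mul, ← Finset.mul_sum]
      exact inv_mul_cancel₀ hsum.ne'
    have h2 : f (c • y) ≤ r := hmax hmem
    obtain ⟨i, -, hi⟩ := Finset.exists_mem_eq_inf' (s := (Finset.univ : Finset V))
      Finset.univ_nonempty
      (fun i => M.mulVec (B.mulVec (c • y)) i / B.mulVec (c • y) i)
    have h3 : M.mulVec (B.mulVec (c • y)) i / B.mulVec (c • y) i ≤ r := hi ▸ h2
    have hBy : 0 < B.mulVec (c • y) i := hBpos _ hmem.1 (hne0 _ hmem) i
    rw [div_le_iff₀ hBy] at h3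
    have h4 := h1 i
    rw [Matrix.mulVec_sub, hcomm, Matrix.mulVec_smul] at h4
    simp only [Matrix.mulVec_smul, Pi.smul_apply, Pi.sub_apply, smul_eq_mul] at h3 h4
    nlinarith
  obtain ⟨i₀⟩ := ‹Nonempty V›
  have hr0 : 0 ≤ r := by
    have h5 := congrFun heq i₀
    have h6 : 0 ≤ M.mulVec y i₀ := Finset.sum_nonneg fun j _ => mul_nonneg (hnn _ _) (hypos j).le
    rw [h5] at h6
    exact nonneg_of_mul_nonneg_left h6 (hypos i₀)
  have hr1 : r ≠ 0 := by
    intro h0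
    have h7 : M.mulVec (B.mulVec y) = 0 := by
      rw [← hcomm, heq, h0, zero_smul, Matrix.mulVec_zero]
    have hy2 : ∀ i, 0 < B.mulVec y i :=
      hBpos y (fun i => (hypos i).le) (fun h => (hypos i₀).ne' (congrFun h i₀))
    have hM0 : ∀ j, M i₀ j = 0 := by
      intro j
      have h8 := congrFun h7 i₀
      simp only [Matrix.mulVec, dotProduct, Pi.zero_apply] at h8
      have h9 := (Finset.sum_eq_zero_iff_of_nonneg
        (fun j _ => mul_nonneg (hnn i₀ j) (hy2 j).le)).1 h8 j (Finset.mem_univ j)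
      exact (mul_eq_zero.1 h9).resolve_right (hy2 j).ne'
    have h10 : M.mulVec y i₀ = 0 := by simp [Matrix.mulVec, dotProduct, hM0]
    cases k with
    | zero => exact absurd hk (lt_irrefl 0)
    | succ n =>
      have h11 := hB i₀ i₀
      rw [hBdef, pow_succ', Matrix.mul_apply] at h11
      simp [hM0] at h11
  exact ⟨r, y, lt_of_le_of_ne hr0 (Ne.symm hr1), hypos, heq⟩

theorem isPrimitive_transpose {V : Type*} [Fintype V] [DecidableEq V]
    {M : Matrix V V ℝ} (hM : M.IsPrimitive) : M.transpose.IsPrimitive := by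
  obtain ⟨hnn, k, hk, hB⟩ := hM
  exact ⟨fun i j => hnn j i, k, hk, fun i j => by
    rw [← Matrix.transpose_pow]; exact hB j i⟩

/-- Existence of Perron-Frobenius data of a primitive matrix. -/
theorem exists_isPerron {V : Type*} [Fintype V] [DecidableEq V] [Nonempty V]
    {M : Matrix V V ℝ} (hM : M.IsPrimitive) : ∃ lam vL vR, IsPerron M lam vL vR := by
  obtain ⟨l, v, hl, hv, hlv⟩ := exists_pos_eigenvector hM
  obtain ⟨l', u, -, hu, hlu⟩ := exists_pos_eigenvector (isPrimitive_transpose hM)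
  rw [Matrix.mulVec_transpose] at hlu
  have huv : 0 < dotProduct u v :=
    Finset.sum_pos (fun i _ => mul_pos (hu i) (hv i)) Finset.univ_nonempty
  have hll : l' = l := by
    have h := Matrix.dotProduct_mulVec u M v
    rw [hlv, hlu, dotProduct_smul, smul_dotProduct] at h
    exact (mul_right_cancel₀ huv.ne' h).symm
  refine ⟨l, (dotProduct u v)⁻¹ • u, v, hl, fun i => mul_pos (inv_pos.2 huv) (hu i), hv, ?_, hlv, ?_⟩
  · rw [Matrix.smul_vecMul, hlu, hll, smul_comm]
  · rw [smul_dotProduct, smul_eq_mul, inv_mul_cancel₀ huv.ne']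

theorem pos_eigenvector_unique {V : Type*} [Fintype V] [DecidableEq V] [Nonempty V]
    {M : Matrix V V ℝ} (hM : M.IsPrimitive) {l : ℝ} {v u : V → ℝ}
    (hu : ∀ i, 0 < u i) (hlv : Matrix.mulVec M v = l • v) (hlu : Matrix.mulVec M u = l • u) :
    ∃ c : ℝ, v = c • u := by
  obtain ⟨-, k, -, hB⟩ := hM
  obtain ⟨i, -, hi⟩ := Finset.exists_mem_eq_inf' (s := (Finset.univ : Finset V))
    Finset.univ_nonempty (fun i => v i / u i)
  refine ⟨v i / u i, ?_⟩
  by_contra hne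
  set z := v - (v i / u i) • u with hz
  have hz0 : z ≠ 0 := sub_ne_zero.2 hne
  have hznn : 0 ≤ z := fun j => by
    have h : v i / u i ≤ v j / u j := hi ▸ Finset.inf'_le _ (Finset.mem_univ j)
    rw [le_div_iff₀ (hu j)] at h
    simpa [hz] using h
  have hzi : z i = 0 := by simp [hz, (hu i).ne']
  have hMz : Matrix.mulVec M z = l • z := by
    rw [hz, Matrix.mulVec_sub, Matrix.mulVec_smul, hlv, hlu, smul_sub, smul_comm]
  have hpow : ∀ n : ℕ, Matrix.mulVec (M ^ n) z = l ^ n • z := by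
    intro n
    induction n with
    | zero => simp
    | succ n ih => rw [pow_succ, ← Matrix.mulVec_mulVec, hMz, Matrix.mulVec_smul, ih, smul_smul,
        pow_succ, mul_comm]
  obtain ⟨j, hj⟩ := Function.ne_iff.1 hz0
  have h1 : 0 < Matrix.mulVec (M ^ k) z i :=
    Finset.sum_pos' (fun l _ => mul_nonneg (hB i l).le (hznn l))
      ⟨j, Finset.mem_univ _, mul_pos (hB i j) (lt_of_le_of_ne (hznn j) (Ne.symm hj))⟩
  rw [hpow, Pi.smul_apply, hzi, smul_zero] at h1
  exact lt_irrefl _ h1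

/-- Cylinder weights do not depend on the choice of the Perron-Frobenius data. -/
theorem isPerron_weight_unique {V : Type*} [Fintype V] [DecidableEq V] [Nonempty V]
    {M : Matrix V V ℝ} (hM : M.IsPrimitive) {l l' : ℝ} {vL vR uL uR : V → ℝ}
    (h : IsPerron M l vL vR) (h' : IsPerron M l' uL uR) (X : Matrix V V ℝ) (k : ℕ) :
    (l ^ k)⁻¹ * dotProduct vL (Matrix.mulVec X vR) =
      (l' ^ k)⁻¹ * dotProduct uL (Matrix.mulVec X uR) := by
  have hpos : 0 < dotProduct vL uR :=
    Finset.sum_pos (fun i _ => mul_pos (h.vL_pos i) (h'.vR_pos i)) Finset.univ_nonempty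
  have hll : l' = l := by
    have e := Matrix.dotProduct_mulVec vL M uR
    rw [h'.right_eigen, h.left_eigen, dotProduct_smul, smul_dotProduct] at e
    exact mul_right_cancel₀ hpos.ne' e
  subst hll
  obtain ⟨c, hc⟩ := pos_eigenvector_unique hM h'.vR_pos h.right_eigen h'.right_eigen
  obtain ⟨d, hd⟩ := pos_eigenvector_unique (isPrimitive_transpose hM) (v := vL) h'.vL_pos
    (by rw [Matrix.mulVec_transpose, h.left_eigen])
    (by rw [Matrix.mulVec_transpose, h'.left_eigen])
  have hcd := h.normalised
  rw [hc, hd, smul_dotProduct, dotProduct_smul, h'.normalised] at hcd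
  simp only [smul_eq_mul, mul_one] at hcd
  rw [hc, hd, Matrix.mulVec_smul, smul_dotProduct, dotProduct_smul]
  simp only [smul_eq_mul]
  rw [← mul_assoc d c, hcd, one_mul]

namespace LabelledGraph

variable {V E : Type*} {A : Finset ℤ}

/-- The one-sided sofic shift `𝒦⁺`: the label sequences of all infinite paths, starting anywhere. -/
def shift (G : LabelledGraph V E A) : Set (ℕ → A) :=
  {x | ∃ e : ℕ → E, (∀ n, G.term (e n) = G.init (e (n + 1))) ∧ ∀ n, G.label (e n) = x n}

/-- The cylinder set of all elements of `𝒦⁺` with initial word `w`. -/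
def cylinder (G : LabelledGraph V E A) {k : ℕ} (w : Fin k → A) : Set G.shift :=
  {x | ∀ i : Fin k, x.1 i = w i}

open Classical in
/-- The `a`-transition matrix `M_a`. -/
noncomputable def transitionMatrix (G : LabelledGraph V E A) (a : A) : Matrix V V ℝ :=
  Matrix.of fun i j => if ∃ e, G.init e = i ∧ G.term e = j ∧ G.label e = a then 1 else 0

/-- The matrix `M = ∑ₐ M_a`. -/
noncomputable def matrix (G : LabelledGraph V E A) : Matrix V V ℝ :=
  ∑ a : A, G.transitionMatrix a

/-- The product `M_{w₁} ⋯ M_{w_k}` along a word, in this order. -/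
noncomputable def wordMatrix [Fintype V] [DecidableEq V] (G : LabelledGraph V E A) {k : ℕ}
    (w : Fin k → A) : Matrix V V ℝ :=
  (List.ofFn fun i => G.transitionMatrix (w i)).prod

theorem transitionMatrix_nonneg (G : LabelledGraph V E A) (a : A) (i j : V) :
    0 ≤ G.transitionMatrix a i j := by
  classical
  simp only [transitionMatrix, Matrix.of_apply]
  split_ifs <;> norm_num

theorem sum_transitionMatrix (G : LabelledGraph V E A) (i j : V) :
    ∑ a : A, G.transitionMatrix a i j = G.matrix i j := by
  simp [matrix, Matrix.sum_apply]

theorem wordMatrix_snoc [Fintype V] [DecidableEq V] (G : LabelledGraph V E A) {k : ℕ}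
    (w : Fin (k + 1) → A) :
    G.wordMatrix w = G.wordMatrix (fun i : Fin k => w i.castSucc) *
      G.transitionMatrix (w (Fin.last k)) := by
  simp only [wordMatrix]
  rw [List.ofFn_succ', List.concat_eq_append, List.prod_append, List.prod_singleton]

end LabelledGraph

section Markov

variable {V : Type*} [Fintype V] {A : Finset ℤ}

/-- The measure on a finite discrete space with given point weights. -/
noncomputable def weightMeasure {S : Type*} [Fintype S] [MeasurableSpace S] (f : S → ℝ) :
    Measure S := ∑ s, ENNReal.ofReal (f s) • Measure.dirac s

theorem weightMeasure_singleton {S : Type*} [Fintype S] [MeasurableSpace S]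
    [MeasurableSingletonClass S] (f : S → ℝ) (s : S) :
    weightMeasure f {s} = ENNReal.ofReal (f s) := by
  classical
  simp only [weightMeasure, Measure.finsetSum_apply, Measure.smul_apply, smul_eq_mul]
  rw [Finset.sum_eq_single s]
  · simp
  · intro b _ hb
    simp [hb]
  · simp

theorem isProbabilityMeasure_weightMeasure {S : Type*} [Fintype S] [MeasurableSpace S]
    (f : S → ℝ) (hf : ∀ s, 0 ≤ f s) (h1 : ∑ s, f s = 1) :
    IsProbabilityMeasure (weightMeasure f) := by
  constructor
  simp only [weightMeasure, Measure.finsetSum_apply, Measure.smul_apply, smul_eq_mul,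
    measure_univ, mul_one]
  rw [← ENNReal.ofReal_sum_of_nonneg (fun s _ => hf s), h1, ENNReal.ofReal_one]

/-- Existence of a Markov chain on a finite space `A × V`, where the next state depends only on the
current `V`-component, with given initial weights `f` and transition weights `p`. -/
theorem exists_markov [MeasurableSpace V] [MeasurableSingletonClass V]
    (f : A × V → ℝ) (p : V → A × V → ℝ)
    (hf : ∀ s, 0 ≤ f s) (hf1 : ∑ s, f s = 1) (hp : ∀ v s, 0 ≤ p v s) (hp1 : ∀ v, ∑ s, p v s = 1) :
    ∃ P : Measure (ℕ → A × V), IsProbabilityMeasure P ∧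
      (∀ s, P {x | x 0 = s} = ENNReal.ofReal (f s)) ∧
      ∀ (n : ℕ) (B : Set (Finset.Iic n → A × V)) (s : A × V),
        P {x | (fun i : Finset.Iic n => x i) ∈ B ∧ x (n + 1) = s} =
          ∑ v, P {x | (fun i : Finset.Iic n => x i) ∈ B ∧ (x n).2 = v} * ENNReal.ofReal (p v s) := by
  classical
  have hprob : ∀ v, IsProbabilityMeasure (weightMeasure (p v)) := fun v =>
    isProbabilityMeasure_weightMeasure _ (hp v) (hp1 v)
  have := isProbabilityMeasure_weightMeasure f hf hf1
  let q : ProbabilityTheory.Kernel V (A × V) :=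
    ProbabilityTheory.Kernel.ofFunOfCountable (fun v => weightMeasure (p v))
  have : ProbabilityTheory.IsMarkovKernel q := ⟨hprob⟩
  let κ : (n : ℕ) → ProbabilityTheory.Kernel (Finset.Iic n → A × V) (A × V) := fun n =>
    q.comap (fun y => (y ⟨n, Finset.mem_Iic.2 le_rfl⟩).2) (by fun_prop)
  have : ∀ n, ProbabilityTheory.IsMarkovKernel (κ n) := fun n => by
    dsimp only [κ]; infer_instance
  let P := ProbabilityTheory.Kernel.trajMeasure (X := fun _ => A × V) (weightMeasure f) κ
  have hm : ∀ (n : ℕ) (B : Set (Finset.Iic n → A × V)), MeasurableSet B := fun n B =>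
    B.toFinite.measurableSet
  refine ⟨P, inferInstance, fun s => ?_, fun n B s => ?_⟩
  · have h0 : P.map (Preorder.frestrictLe (π := fun _ => A × V) 0) =
        (weightMeasure f).map
          (MeasurableEquiv.piUnique (fun _ : Finset.Iic 0 => A × V)).symm := by
      dsimp only [P]
      rw [ProbabilityTheory.Kernel.trajMeasure, Measure.map_comp _ _ (by fun_prop),
        ProbabilityTheory.Kernel.traj_map_frestrictLe,
        ProbabilityTheory.Kernel.partialTraj_self, Measure.id_comp]
    have h1 := congrArg (fun m => m {y | y ⟨0, Finset.mem_Iic.2 le_rfl⟩ = s}) h0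
    beta_reduce at h1
    rw [Measure.map_apply (by fun_prop) (hm 0 _), Measure.map_apply (by fun_prop) (hm 0 _)] at h1
    refine Eq.trans ?_ (h1.trans ?_)
    · rfl
    · rw [← weightMeasure_singleton f s]
      rfl
  · have h := ProbabilityTheory.Kernel.map_frestrictLe_trajMeasure_compProd_eq_map_trajMeasure
      (X := fun _ => A × V) (μ₀ := weightMeasure f) (κ := κ) (a := n)
    have h2 := congrArg (fun m => m (B ×ˢ {s})) h
    beta_reduce at h2
    rw [Measure.compProd_apply_prod (hm n B) (measurableSet_singleton s),
      Measure.map_apply (by fun_prop) ((hm n B).prod (measurableSet_singleton s))] at h2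
    refine (Eq.trans ?_ h2.symm).trans ?_
    · rfl
    · have hk : ∀ y : Finset.Iic n → A × V, κ n y {s} = ∑ v,
          ({y : Finset.Iic n → A × V | (y ⟨n, Finset.mem_Iic.2 le_rfl⟩).2 = v}).indicator 1 y *
            ENNReal.ofReal (p v s) := by
        intro y
        rw [Finset.sum_eq_single (y ⟨n, Finset.mem_Iic.2 le_rfl⟩).2]
        · rw [Set.indicator_of_mem (show y ∈ {z : Finset.Iic n → A × V |
              (z ⟨n, Finset.mem_Iic.2 le_rfl⟩).2 = (y ⟨n, Finset.mem_Iic.2 le_rfl⟩).2} from rfl), Pi.one_apply, one_mul, ← weightMeasure_singleton]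
          rfl
        · intro v _ hv
          rw [Set.indicator_of_notMem (fun h => hv (Set.mem_ofPred.1 h).symm), zero_mul]
        · simp
      simp_rw [hk]
      rw [lintegral_finsetSum _ (fun v _ => measurable_of_finite _)]
      refine Finset.sum_congr rfl fun v _ => ?_
      rw [lintegral_mul_const _ (measurable_of_finite _), lintegral_indicator_one (hm n _),
        Measure.restrict_apply (hm n _), Measure.map_apply (by fun_prop) (hm n _)]
      congr 2
      ext x
      exact and_comm

end Markov

namespace LabelledGraph

variable {V E : Type*} {A : Finset ℤ} [Fintype V] [DecidableEq V] [Nonempty V]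

/-- Existence of the measure on `𝒦⁺` with the Parry weights on cylinder sets. -/
theorem exists_parryMeasure (G : LabelledGraph V E A) (hG : G.matrix.IsPrimitive) :
    ∃ μ : Measure G.shift, IsProbabilityMeasure μ ∧
      ∀ (lam : ℝ) (vL vR : V → ℝ), IsPerron G.matrix lam vL vR →
        ∀ (k : ℕ) (w : Fin k → A), μ (G.cylinder w) =
          ENNReal.ofReal ((lam ^ k)⁻¹ * dotProduct vL (Matrix.mulVec (G.wordMatrix w) vR)) := by
  classical
  obtain ⟨l, vL, vR, hP⟩ := exists_isPerron hG
  suffices h : ∃ μ : Measure G.shift, IsProbabilityMeasure μ ∧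
      ∀ (k : ℕ) (w : Fin k → A), μ (G.cylinder w) =
        ENNReal.ofReal ((l ^ k)⁻¹ * dotProduct vL (Matrix.mulVec (G.wordMatrix w) vR)) by
    obtain ⟨μ, h1, h2⟩ := h
    exact ⟨μ, h1, fun lam uL uR hu k w => by
      rw [h2, isPerron_weight_unique hG hP hu]⟩
  let _ : MeasurableSpace V := ⊤
  have hl := hP.lam_pos
  have hMnn := G.transitionMatrix_nonneg
  let f : A × V → ℝ := fun s => Matrix.vecMul vL (G.transitionMatrix s.1) s.2 * vR s.2 / l
  let p : V → A × V → ℝ := fun v s => G.transitionMatrix s.1 v s.2 * vR s.2 / (l * vR v)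
  have hvM : ∀ (w : Matrix V V ℝ), (∀ i j, 0 ≤ w i j) → ∀ j, 0 ≤ Matrix.vecMul vL w j :=
    fun w hw j => Finset.sum_nonneg fun i _ => mul_nonneg (hP.vL_pos i).le (hw i j)
  have hf : ∀ s, 0 ≤ f s := fun s =>
    div_nonneg (mul_nonneg (hvM _ (hMnn _) _) (hP.vR_pos _).le) hl.le
  have hp : ∀ v s, 0 ≤ p v s := fun v s =>
    div_nonneg (mul_nonneg (hMnn _ _ _) (hP.vR_pos _).le) (mul_pos hl (hP.vR_pos v)).le
  have hf1 : ∑ s, f s = 1 := by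
    have h : ∀ v, ∑ a : A, Matrix.vecMul vL (G.transitionMatrix a) v = l * vL v := fun v => by
      have := congrFun hP.left_eigen v
      simp only [Pi.smul_apply, smul_eq_mul] at this
      rw [← this]
      simp only [Matrix.vecMul, dotProduct]
      rw [Finset.sum_comm]
      simp_rw [← Finset.mul_sum, sum_transitionMatrix]
    rw [Fintype.sum_prod_type_right]
    simp only [f]
    simp_rw [← Finset.sum_div, ← Finset.sum_mul, h]
    have h3 := hP.normalised
    simp only [dotProduct] at h3
    rw [div_eq_one_iff_eq hl.ne']
    simp_rw [mul_assoc]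
    rw [← Finset.mul_sum, h3, mul_one]
  have hp1 : ∀ v, ∑ s, p v s = 1 := by
    intro v
    have := congrFun hP.right_eigen v
    simp only [Matrix.mulVec, dotProduct, Pi.smul_apply, smul_eq_mul] at this
    rw [Fintype.sum_prod_type_right]
    simp only [p]
    simp_rw [← Finset.sum_div, ← Finset.sum_mul, sum_transitionMatrix]
    rw [this, div_self (mul_pos hl (hP.vR_pos v)).ne']
  obtain ⟨P, hPp, hP0, hPs⟩ := exists_markov f p hf hf1 hp hp1
  have hWnn : ∀ (k : ℕ) (w : Fin k → A) (i j : V), 0 ≤ G.wordMatrix w i j := by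
    intro k
    induction k with
    | zero =>
      intro w i j
      simp only [wordMatrix, List.ofFn_zero, List.prod_nil, Matrix.one_apply]
      split_ifs <;> norm_num
    | succ k ih =>
      intro w i j
      rw [wordMatrix_snoc, Matrix.mul_apply]
      exact Finset.sum_nonneg fun m _ => mul_nonneg (ih _ _ _) (hMnn _ _ _)
  have key : ∀ (n : ℕ) (w : Fin (n + 1) → A) (v : V),
      P {x | (∀ i : Fin (n + 1), (x i).1 = w i) ∧ (x n).2 = v} =
        ENNReal.ofReal ((l ^ (n + 1))⁻¹ * (Matrix.vecMul vL (G.wordMatrix w) v * vR v)) := by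
    intro n
    induction n with
    | zero =>
      intro w v
      have hset : {x : ℕ → A × V | (∀ i : Fin (0 + 1), (x i).1 = w i) ∧ (x 0).2 = v} =
          {x | x 0 = (w 0, v)} := by
        ext x
        simp [Prod.ext_iff]
      rw [hset, hP0]
      congr 1
      simp only [f, wordMatrix]
      simp
      ring
    | succ n ih =>
      intro w v
      have hset : {x : ℕ → A × V | (∀ i : Fin (n + 1 + 1), (x i).1 = w i) ∧ (x (n + 1)).2 = v} =
          {x | (fun i : Finset.Iic n => x i) ∈
            {y : Finset.Iic n → A × V | ∀ i : Fin (n + 1),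
              (y ⟨i, Finset.mem_Iic.2 (Nat.lt_succ_iff.1 i.2)⟩).1 = w i.castSucc} ∧
            x (n + 1) = (w (Fin.last _), v)} := by
        ext x
        simp only [Set.mem_ofPred, Fin.forall_fin_succ', Prod.ext_iff, Fin.val_castSucc,
          Fin.val_last]
        tauto
      rw [hset, hPs]
      have hset2 : ∀ u, {x : ℕ → A × V | (fun i : Finset.Iic n => x i) ∈
            {y : Finset.Iic n → A × V | ∀ i : Fin (n + 1),
              (y ⟨i, Finset.mem_Iic.2 (Nat.lt_succ_iff.1 i.2)⟩).1 = w i.castSucc} ∧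
            (x n).2 = u} =
          {x | (∀ i : Fin (n + 1), (x i).1 = w i.castSucc) ∧ (x n).2 = u} := fun u => rfl
      simp_rw [hset2, ih]
      have hnn : ∀ u, 0 ≤ (l ^ (n + 1))⁻¹ *
          (Matrix.vecMul vL (G.wordMatrix fun i : Fin (n + 1) => w i.castSucc) u * vR u) :=
        fun u => mul_nonneg (inv_nonneg.2 (pow_nonneg hl.le _))
          (mul_nonneg (hvM _ (hWnn _ _) _) (hP.vR_pos u).le)
      simp_rw [← ENNReal.ofReal_mul (hnn _)]
      rw [← ENNReal.ofReal_sum_of_nonneg (fun u _ => mul_nonneg (hnn u) (hp _ _))]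
      congr 1
      rw [G.wordMatrix_snoc w, ← Matrix.vecMul_vecMul]
      conv_rhs => rw [Matrix.vecMul, dotProduct, Finset.sum_mul, Finset.mul_sum]
      refine Finset.sum_congr rfl fun u _ => ?_
      simp only [p]
      have := (hP.vR_pos u).ne'
      field_simp
      ring
  have keycyl : ∀ (k : ℕ) (w : Fin k → A), P {x | ∀ i : Fin k, (x i).1 = w i} =
      ENNReal.ofReal ((l ^ k)⁻¹ * dotProduct vL (Matrix.mulVec (G.wordMatrix w) vR)) := by
    intro k w
    cases k with
    | zero =>
      have hset : {x : ℕ → A × V | ∀ i : Fin 0, (x i).1 = w i} = Set.univ := by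
        ext x; simp
      rw [hset, measure_univ]
      simp [wordMatrix, hP.normalised]
    | succ n =>
      have hset : {x : ℕ → A × V | ∀ i : Fin (n + 1), (x i).1 = w i} =
          ⋃ v, {x | (∀ i : Fin (n + 1), (x i).1 = w i) ∧ (x n).2 = v} := by
        ext x; simp
      have hmeas : ∀ v, MeasurableSet
          {x : ℕ → A × V | (∀ i : Fin (n + 1), (x i).1 = w i) ∧ (x n).2 = v} := by
        intro v
        measurability
      rw [hset, measure_iUnion ?_ hmeas, tsum_fintype]
      · simp_rw [key]
        rw [← ENNReal.ofReal_sum_of_nonneg]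
        · rw [← Finset.mul_sum, Matrix.dotProduct_mulVec]
          rfl
        · exact fun u _ => mul_nonneg (inv_nonneg.2 (pow_nonneg hl.le _))
            (mul_nonneg (hvM _ (hWnn _ _) _) (hP.vR_pos u).le)
      · intro u v huv
        refine Set.disjoint_left.2 fun x hx hx' => huv ?_
        exact (Set.mem_ofPred.1 hx).2.symm.trans (Set.mem_ofPred.1 hx').2
  let R0 : A × V → Prop := fun s => ∃ e, G.term e = s.2 ∧ G.label e = s.1
  let R : A × V → A × V → Prop := fun s t =>
    ∃ e, G.init e = s.2 ∧ G.term e = t.2 ∧ G.label e = t.1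
  let T : Set (ℕ → A × V) := {x | R0 (x 0) ∧ ∀ n, R (x n) (x (n + 1))}
  have hT : MeasurableSet T := by
    have h0 : MeasurableSet {x : ℕ → A × V | R0 (x 0)} :=
      measurable_pi_apply (X := fun _ : ℕ => A × V) 0 (Set.toFinite {s | R0 s}).measurableSet
    have h1 : ∀ n : ℕ, MeasurableSet {x : ℕ → A × V | R (x n) (x (n + 1))} := fun n =>
      ((measurable_pi_apply (X := fun _ : ℕ => A × V) n).prodMk
        (measurable_pi_apply (X := fun _ : ℕ => A × V) (n + 1)))
        (Set.toFinite {s : (A × V) × (A × V) | R s.1 s.2}).measurableSet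
    have : T = {x | R0 (x 0)} ∩ ⋂ n, {x | R (x n) (x (n + 1))} := by
      ext x; simp [T]
    rw [this]
    exact h0.inter (MeasurableSet.iInter h1)
  have hae : ∀ᵐ x ∂P, x ∈ T := by
    have h0 : ∀ᵐ x ∂P, R0 (x 0) := by
      have hz : ∀ s, ¬ R0 s → ∀ᵐ x ∂P, x 0 ≠ s := by
        intro s hs
        rw [ae_iff]
        simp only [not_not]
        rw [hP0]
        have : f s = 0 := by
          have h : ∀ i, G.transitionMatrix s.1 i s.2 = 0 := fun i => by
            simp only [transitionMatrix, Matrix.of_apply]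
            exact if_neg fun ⟨e, _, h2, h3⟩ => hs ⟨e, h2, h3⟩
          simp [f, Matrix.vecMul, dotProduct, h]
        rw [this, ENNReal.ofReal_zero]
      have := ae_all_iff.2 fun s => (ae_all_iff (μ := P)).2 fun h => hz s h
      filter_upwards [this] with x hx
      by_contra hc
      exact hx _ hc rfl
    have h1 : ∀ n : ℕ, ∀ᵐ x ∂P, R (x n) (x (n + 1)) := by
      intro n
      have hz : ∀ (v : V) (t : A × V), ¬ (∃ e, G.init e = v ∧ G.term e = t.2 ∧ G.label e = t.1) →
          ∀ᵐ x ∂P, ¬ ((x n).2 = v ∧ x (n + 1) = t) := by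
        intro v t hvt
        rw [ae_iff]
        simp only [not_not]
        have := hPs n {y | (y ⟨n, Finset.mem_Iic.2 le_rfl⟩).2 = v} t
        refine Eq.trans ?_ (this.trans ?_)
        · rfl
        · refine Finset.sum_eq_zero fun u _ => ?_
          by_cases huv : u = v
          · have h0 : p u t = 0 := by
              have : G.transitionMatrix t.1 u t.2 = 0 := by
                simp only [transitionMatrix, Matrix.of_apply]
                exact if_neg (huv ▸ hvt)
              simp [p, this]
            rw [h0, ENNReal.ofReal_zero, mul_zero]
          · have hemp : {x : ℕ → A × V | (fun i : Finset.Iic n => x i) ∈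
                {y : Finset.Iic n → A × V | (y ⟨n, Finset.mem_Iic.2 le_rfl⟩).2 = v} ∧
                (x n).2 = u} = ∅ := by
              ext x
              simp only [Set.mem_ofPred, Set.mem_empty_iff_false, iff_false, not_and]
              exact fun h h' => huv (h'.symm.trans h)
            rw [hemp, measure_empty, zero_mul]
      have := ae_all_iff.2 fun v => (ae_all_iff (μ := P)).2 fun t => (ae_all_iff (μ := P)).2
        fun h => hz v t h
      filter_upwards [this] with x hx
      by_contra hc
      exact hx _ _ hc ⟨rfl, rfl⟩
    filter_upwards [h0, ae_all_iff.2 h1] with x hx hx'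
    exact ⟨hx, hx'⟩
  have hg : ∀ x : T, (fun n => (x.1 n).1) ∈ G.shift := by
    rintro ⟨x, ⟨e0, he0, he0'⟩, hx⟩
    have hx2 := hx
    choose e he using hx2
    refine ⟨fun n => Nat.casesOn n e0 e, fun n => ?_, fun n => ?_⟩
    · cases n with
      | zero => exact he0.trans (he 0).1.symm
      | succ n => exact (he n).2.1.trans (he (n + 1)).1.symm
    · cases n with
      | zero => exact he0'
      | succ n => exact (he n).2.2
  let g : T → G.shift := fun x => ⟨_, hg x⟩
  have hgm : Measurable g := by
    refine Measurable.subtype_mk (measurable_pi_lambda _ fun n => ?_)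
    exact measurable_fst.comp ((measurable_pi_apply n).comp measurable_subtype_coe)
  have hcylm : ∀ (k : ℕ) (w : Fin k → A), MeasurableSet (G.cylinder w) := by
    intro k w
    have : G.cylinder w = ⋂ i : Fin k, (fun x : G.shift => x.1 i) ⁻¹' {w i} := by
      ext x; simp [cylinder]
    rw [this]
    exact MeasurableSet.iInter fun i =>
      ((measurable_pi_apply (i : ℕ)).comp measurable_subtype_coe) (measurableSet_singleton _)
  have hcyl : ∀ (k : ℕ) (w : Fin k → A), (P.comap (Subtype.val : T → _)).map g (G.cylinder w) =
      ENNReal.ofReal ((l ^ k)⁻¹ * dotProduct vL (Matrix.mulVec (G.wordMatrix w) vR)) := by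
    intro k w
    rw [Measure.map_apply hgm (hcylm k w), (MeasurableEmbedding.subtype_coe hT).comap_apply,
      ← keycyl]
    refine measure_congr ?_
    filter_upwards [hae] with x hx
    refine propext ⟨?_, fun h => ?_⟩
    · rintro ⟨y, hy, rfl⟩
      exact hy
    · exact ⟨⟨x, hx⟩, h, rfl⟩
  refine ⟨_, ⟨?_⟩, hcyl⟩
  have h0 := hcyl 0 Fin.elim0
  have hu : G.cylinder (Fin.elim0 : Fin 0 → A) = Set.univ := by
    ext x; simp [cylinder]
  rw [hu] at h0
  rw [h0]
  simp [wordMatrix, hP.normalised]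

/-- The Parry measure `μ⁺` on `𝒦⁺`: the probability measure with
`μ⁺[w₁, …, w_k] = λ⁻ᵏ vLᵀ M_{w₁} ⋯ M_{w_k} vR` for all cylinder sets, where `λ`, `vL`, `vR` are
Perron-Frobenius data of `M`. -/
noncomputable def parryMeasure (G : LabelledGraph V E A) (hG : G.matrix.IsPrimitive) :
    Measure G.shift :=
  Classical.choose (G.exists_parryMeasure hG)

instance isProbabilityMeasure_parryMeasure (G : LabelledGraph V E A)
    (hG : G.matrix.IsPrimitive) : IsProbabilityMeasure (G.parryMeasure hG) :=
  (Classical.choose_spec (G.exists_parryMeasure hG)).1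

theorem parryMeasure_cylinder (G : LabelledGraph V E A) (hG : G.matrix.IsPrimitive)
    {lam : ℝ} {vL vR : V → ℝ} (h : IsPerron G.matrix lam vL vR) {k : ℕ} (w : Fin k → A) :
    G.parryMeasure hG (G.cylinder w) =
      ENNReal.ofReal ((lam ^ k)⁻¹ * dotProduct vL (Matrix.mulVec (G.wordMatrix w) vR)) :=
  (Classical.choose_spec (G.exists_parryMeasure hG)).2 lam vL vR h k w

end LabelledGraph

namespace LabelledGraph

variable {V E : Type*} {A : Finset ℤ}

/-- The map `φ⁺ : 𝒦⁺ → ℝ`, `(x₁, x₂, …) ↦ ∑ₖ xₖ β⁻ᵏ`; the sequences are indexed from `0` here. -/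
noncomputable def phi (G : LabelledGraph V E A) (β : ℝ) (x : G.shift) : ℝ :=
  ∑' k : ℕ, ((x.1 k : ℤ) : ℝ) / β ^ (k + 1)

theorem summable_phi (G : LabelledGraph V E A) {β : ℝ} (hβ : 1 < β) (x : G.shift) :
    Summable fun k : ℕ => ((x.1 k : ℤ) : ℝ) / β ^ (k + 1) := by
  have hb : 0 < β := zero_lt_one.trans hβ
  have hg : Summable fun k : ℕ => (∑ a ∈ A, |(a : ℝ)|) * (β⁻¹) ^ (k + 1) :=
    ((summable_nat_add_iff 1).2
      (summable_geometric_of_lt_one (inv_nonneg.2 hb.le) (inv_lt_one_of_one_lt₀ hβ))).mul_left _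
  refine Summable.of_norm_bounded hg fun k => ?_
  rw [Real.norm_eq_abs, abs_div, abs_of_pos (pow_pos hb _), inv_pow, ← div_eq_mul_inv]
  gcongr
  exact Finset.single_le_sum (f := fun a : ℤ => |(a : ℝ)|) (fun a _ => abs_nonneg _) (x.1 k).2

theorem measurable_phi (G : LabelledGraph V E A) {β : ℝ} (hβ : 1 < β) :
    Measurable (G.phi β) := by
  refine measurable_of_tendsto_metrizable (f := fun n (x : G.shift) =>
    ∑ k ∈ Finset.range n, ((x.1 k : ℤ) : ℝ) / β ^ (k + 1)) (fun n => ?_) ?_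
  · refine Finset.measurable_fun_sum _ fun k _ => Measurable.div_const ?_ _
    have h : Measurable fun x : G.shift => x.1 k :=
      (measurable_pi_apply k).comp measurable_subtype_coe
    exact (measurable_of_countable fun a : A => ((a : ℤ) : ℝ)).comp h
  · exact tendsto_pi_nhds.2 fun x => (G.summable_phi hβ x).hasSum.tendsto_sum_nat

/-- The measure `ν = φ⁺_*(μ⁺)`. -/
noncomputable def erdosMeasure [Fintype V] [DecidableEq V] [Nonempty V]
    (G : LabelledGraph V E A) (hG : G.matrix.IsPrimitive) (β : ℝ) : Measure ℝ :=
  (G.parryMeasure hG).map (G.phi β)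

end LabelledGraph

/-- A measure on `ℝ` is (purely) atomic if it is concentrated on the set of its atoms, that is, of
the points of positive mass, and this set is countable. -/
def IsPurelyAtomic (ν : Measure ℝ) : Prop :=
  {x : ℝ | 0 < ν {x}}.Countable ∧ ν {x : ℝ | 0 < ν {x}}ᶜ = 0

/-! Let `X i` be the set of values of infinite paths starting at the vertex `i`; the range of `phi`
is the union of the `X i`. An edge from `i` to `j` with label `a` embeds `X j` into `X i` by the
injective contraction `y ↦ (a + y) / β`. Hence if one `X i` is a single point, primitivity spreads
this to every vertex and the range is finite; `ν` then lives on finitely many points.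

Otherwise every `X i` has two points. Changing a path only after its `n`-th edge moves its value by
a nonzero amount of order `β⁻ⁿ`, so no value is isolated (`exists_near_path`). The range is also
compact, being a continuous image of the space of paths, and is therefore perfect.

For continuity of `ν`, let `R` be the expansion radius. A word can begin an expansion of `x` only if
its inverse branch keeps `x` in `[-R, R]`; `wordMass` weighs these words and bounds `ν {x}`
(`erdosMeasure_singleton_le`). Given two paths from `i` with different values, every `x` is far from
one of them. After `N` steps, with `N` independent of `x`, the inverse branch along that path has
expelled `x` from `[-R, R]`, so a fixed proportion of the mass is lost
(`exists_wordMass_contraction`). Iterating gives masses at most `q ^ k * vR i` with `q < 1`, hence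
`ν {x} = 0`. -/

/-! ### Expansions in base `β` with digits in a finite alphabet. -/

section Expansion

variable {A : Finset ℤ}

/-- The value `∑ₖ uₖ β⁻ᵏ` of a sequence of letters, indexed from `0`. -/
noncomputable def expansionValue (β : ℝ) (u : ℕ → A) : ℝ :=
  ∑' k : ℕ, ((u k : ℤ) : ℝ) / β ^ (k + 1)

/-- A bound for the values of all sequences over the alphabet `A`. -/
noncomputable def expansionRadius (A : Finset ℤ) (β : ℝ) : ℝ :=
  (∑ a ∈ A, |(a : ℝ)|) / (β - 1)

/-- With this normalisation of the radius `R`, an inverse step `x ↦ β x - a` sends the outside of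
`[-R, R]` into itself. -/
theorem abs_letter_le {β : ℝ} (hβ : 1 < β) (a : A) :
    |((a : ℤ) : ℝ)| ≤ (β - 1) * expansionRadius A β := by
  rw [expansionRadius, mul_div_cancel₀ _ (sub_pos.2 hβ).ne']
  exact Finset.single_le_sum (f := fun a : ℤ => |(a : ℝ)|) (fun a _ => abs_nonneg _) a.2

theorem hasSum_expansion_bound {β : ℝ} (hβ : 1 < β) :
    HasSum (fun k : ℕ => (β - 1) * expansionRadius A β / β ^ (k + 1)) (expansionRadius A β) := by
  have hb : 0 < β := zero_lt_one.trans hβ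
  have h := (hasSum_geometric_of_lt_one (inv_nonneg.2 hb.le)
    (inv_lt_one_of_one_lt₀ hβ)).mul_left ((β - 1) * expansionRadius A β / β)
  have hb1 : β - 1 ≠ 0 := (sub_pos.2 hβ).ne'
  have hsum : (β - 1) * expansionRadius A β / β * (1 - β⁻¹)⁻¹ = expansionRadius A β := by
    have : 1 - β⁻¹ = (β - 1) / β := by field_simp
    rw [this]
    field_simp
  rw [hsum] at h
  have hfun : (fun k : ℕ => (β - 1) * expansionRadius A β / β ^ (k + 1)) =
      fun k => (β - 1) * expansionRadius A β / β * β⁻¹ ^ k := by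
    funext k
    rw [pow_succ', inv_pow, ← div_eq_mul_inv, div_div]
  rwa [hfun]

theorem norm_expansion_term_le {β : ℝ} (hβ : 1 < β) (u : ℕ → A) (k : ℕ) :
    ‖((u k : ℤ) : ℝ) / β ^ (k + 1)‖ ≤ (β - 1) * expansionRadius A β / β ^ (k + 1) := by
  have hb : 0 < β ^ (k + 1) := pow_pos (zero_lt_one.trans hβ) _
  rw [Real.norm_eq_abs, abs_div, abs_of_pos hb]
  exact div_le_div_of_nonneg_right (abs_letter_le hβ _) hb.le

theorem summable_expansion {β : ℝ} (hβ : 1 < β) (u : ℕ → A) :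
    Summable fun k : ℕ => ((u k : ℤ) : ℝ) / β ^ (k + 1) :=
  Summable.of_norm_bounded (hasSum_expansion_bound hβ).summable (norm_expansion_term_le hβ u)

theorem abs_expansionValue_le {β : ℝ} (hβ : 1 < β) (u : ℕ → A) :
    |expansionValue β u| ≤ expansionRadius A β :=
  tsum_of_norm_bounded (hasSum_expansion_bound hβ) (norm_expansion_term_le hβ u)

theorem expansionValue_eq {β : ℝ} (hβ : 1 < β) (u : ℕ → A) :
    expansionValue β u = (((u 0 : ℤ) : ℝ) + expansionValue β fun k => u (k + 1)) / β := by
  have hb : β ≠ 0 := (zero_lt_one.trans hβ).ne'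
  rw [expansionValue, (summable_expansion hβ u).tsum_eq_zero_add, expansionValue, add_div,
    ← tsum_div_const]
  congr 1
  · simp
  · refine tsum_congr fun k => ?_
    rw [pow_succ _ (k + 1), div_div]

theorem expansionValue_tail {β : ℝ} (hβ : 1 < β) (u : ℕ → A) :
    (expansionValue β fun k => u (k + 1)) = β * expansionValue β u - ((u 0 : ℤ) : ℝ) := by
  have hb : β ≠ 0 := (zero_lt_one.trans hβ).ne'
  rw [expansionValue_eq hβ u]
  field_simp
  ring

theorem continuous_expansionValue {β : ℝ} (hβ : 1 < β) :
    Continuous (expansionValue β : (ℕ → A) → ℝ) := by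
  refine continuous_tsum (fun k => ?_) (hasSum_expansion_bound (A := A) hβ).summable
    (fun k u => norm_expansion_term_le hβ u k)
  exact (continuous_of_discreteTopology (f := fun a : A => ((a : ℤ) : ℝ))).comp
    (continuous_apply k) |>.div_const _

end Expansion

/-! ### Values of paths: compactness and absence of isolated points. -/

namespace LabelledGraph

variable {V E : Type*} {A : Finset ℤ}

/-- An infinite path of the graph. -/
def IsPath (G : LabelledGraph V E A) (e : ℕ → E) : Prop :=
  ∀ n, G.term (e n) = G.init (e (n + 1))

/-- The value `∑ₖ ℓ(eₖ) β⁻ᵏ` of a sequence of edges. -/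
noncomputable def pathValue (G : LabelledGraph V E A) (β : ℝ) (e : ℕ → E) : ℝ :=
  expansionValue β fun n => G.label (e n)

/-- The set of values of all infinite paths starting at `i`. -/
def valuesFrom (G : LabelledGraph V E A) (β : ℝ) (i : V) : Set ℝ :=
  {x | ∃ e, G.IsPath e ∧ G.init (e 0) = i ∧ G.pathValue β e = x}

/-- Edge sequences remember the vertices visited, which label sequences do not; all later surgery on
sequences is done on paths. -/
theorem range_phi (G : LabelledGraph V E A) (β : ℝ) :
    Set.range (G.phi β) = G.pathValue β '' {e | G.IsPath e} := by
  ext x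
  constructor
  · rintro ⟨⟨u, e, he, hu⟩, rfl⟩
    refine ⟨e, he, ?_⟩
    simp only [pathValue, hu]
    rfl
  · rintro ⟨e, he, rfl⟩
    exact ⟨⟨fun n => G.label (e n), e, he, fun _ => rfl⟩, rfl⟩

theorem range_phi_eq_iUnion (G : LabelledGraph V E A) (β : ℝ) :
    Set.range (G.phi β) = ⋃ i, G.valuesFrom β i := by
  rw [range_phi]
  ext x
  simp only [valuesFrom, Set.mem_iUnion, Set.mem_image, Set.mem_ofPred]
  exact ⟨fun ⟨e, he, h⟩ => ⟨_, e, he, rfl, h⟩, fun ⟨_, e, he, _, h⟩ => ⟨e, he, h⟩⟩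

theorem IsPath.tail {G : LabelledGraph V E A} {e : ℕ → E} (he : G.IsPath e) :
    G.IsPath fun n => e (n + 1) := fun n => he (n + 1)

theorem IsPath.cons {G : LabelledGraph V E A} {e : ℕ → E} (he : G.IsPath e) {e₀ : E}
    (h : G.term e₀ = G.init (e 0)) : G.IsPath (fun n => Nat.casesOn n e₀ e) := fun n => by
  cases n with
  | zero => exact h
  | succ n => exact he n

theorem pathValue_eq (G : LabelledGraph V E A) {β : ℝ} (hβ : 1 < β) (e : ℕ → E) :
    G.pathValue β e = (((G.label (e 0) : ℤ) : ℝ) + G.pathValue β fun n => e (n + 1)) / β :=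
  expansionValue_eq hβ _

/-- The paths form a closed subset of the compact space `ℕ → E`, with `E` finite and discrete, and
the value depends continuously on the path. -/
theorem isClosed_range_phi [Finite E] (G : LabelledGraph V E A) {β : ℝ} (hβ : 1 < β) :
    IsClosed (Set.range (G.phi β)) := by
  let _ : TopologicalSpace E := ⊥
  have : DiscreteTopology E := ⟨rfl⟩
  have hc : IsClosed {e : ℕ → E | G.IsPath e} := by
    have : {e : ℕ → E | G.IsPath e} =
        ⋂ n, (fun e : ℕ → E => (e n, e (n + 1))) ⁻¹' {p | G.term p.1 = G.init p.2} := by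
      ext e
      simp [IsPath]
    rw [this]
    exact isClosed_iInter fun n => (isClosed_discrete _).preimage
      ((continuous_apply n).prodMk (continuous_apply (n + 1)))
  have hv : Continuous (G.pathValue β) :=
    (continuous_expansionValue hβ).comp (continuous_pi fun n =>
      (continuous_of_discreteTopology (f := G.label)).comp (continuous_apply n))
  rw [range_phi]
  exact (hc.isCompact.image hv).isClosed

/-- Perturb the tail and put the first edge back: each edge put back divides the difference of
values by `β`. Keeping the initial vertex fixed is what allows the edge to be reattached. -/
theorem exists_near_path (G : LabelledGraph V E A) {β : ℝ} (hβ : 1 < β)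
    (hnt : ∀ i, (G.valuesFrom β i).Nontrivial) (n : ℕ) :
    ∀ e, G.IsPath e → ∃ e', G.IsPath e' ∧ G.init (e' 0) = G.init (e 0) ∧
      G.pathValue β e' ≠ G.pathValue β e ∧
      |G.pathValue β e' - G.pathValue β e| ≤ 2 * expansionRadius A β / β ^ n := by
  have hb : 0 < β := zero_lt_one.trans hβ
  induction n with
  | zero =>
    intro e he
    -- Of two distinct values from this vertex, at least one differs from that of `e`; both lie in
    -- `[-R, R]`.
    obtain ⟨_, ⟨e', he', h0, rfl⟩, hne⟩ := (hnt (G.init (e 0))).exists_ne (G.pathValue β e)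
    refine ⟨e', he', h0, hne, ?_⟩
    have h1 := abs_expansionValue_le hβ fun n => G.label (e' n)
    have h2 := abs_expansionValue_le hβ fun n => G.label (e n)
    have := abs_sub (G.pathValue β e') (G.pathValue β e)
    simp only [pathValue] at *
    rw [pow_zero, div_one]
    linarith
  | succ n ih =>
    intro e he
    obtain ⟨e', he', h0, hne, hle⟩ := ih _ he.tail
    refine ⟨_, he'.cons (e₀ := e 0) ((he 0).trans h0.symm), rfl, ?_, ?_⟩
    · rw [G.pathValue_eq hβ, G.pathValue_eq hβ e, ne_eq, div_left_inj' hb.ne']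
      exact fun h => hne (add_left_cancel h)
    · rw [G.pathValue_eq hβ, G.pathValue_eq hβ e, ← sub_div, abs_div, abs_of_pos hb, pow_succ,
        ← div_div]
      refine div_le_div_of_nonneg_right ?_ hb.le
      simpa using hle

theorem perfect_range_phi [Finite E] (G : LabelledGraph V E A) {β : ℝ} (hβ : 1 < β)
    (hnt : ∀ i, (G.valuesFrom β i).Nontrivial) : Perfect (Set.range (G.phi β)) := by
  refine ⟨G.isClosed_range_phi hβ, preperfect_iff_nhds.2 fun x hx U hU => ?_⟩
  rw [range_phi] at hx ⊢
  obtain ⟨e, he, rfl⟩ := hx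
  obtain ⟨ε, hε, hU⟩ := Metric.mem_nhds_iff.1 hU
  obtain ⟨n, hn⟩ := pow_unbounded_of_one_lt (2 * expansionRadius A β / ε) hβ
  obtain ⟨e', he', -, hne, hle⟩ := G.exists_near_path hβ hnt n e he
  refine ⟨_, ⟨hU ?_, e', he', rfl⟩, hne⟩
  rw [Metric.mem_ball, Real.dist_eq]
  refine hle.trans_lt ?_
  rw [div_lt_iff₀ hε] at hn
  rw [div_lt_iff₀ (pow_pos (zero_lt_one.trans hβ) n)]
  linarith

theorem exists_edge [Fintype V] (G : LabelledGraph V E A) {i j : V} (h : G.matrix i j ≠ 0) :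
    ∃ e, G.init e = i ∧ G.term e = j := by
  classical
  rw [← G.sum_transitionMatrix] at h
  obtain ⟨a, -, ha⟩ := Finset.exists_ne_zero_of_sum_ne_zero h
  simp only [transitionMatrix, Matrix.of_apply, ne_eq, ite_eq_right_iff, one_ne_zero, imp_false,
    not_not] at ha
  obtain ⟨e, h1, h2, -⟩ := ha
  exact ⟨e, h1, h2⟩

theorem exists_matrix_ne_zero_of_pow {V : Type*} [Fintype V] [DecidableEq V] {M : Matrix V V ℝ}
    {k : ℕ} {i j : V} (h : (M ^ (k + 1)) i j ≠ 0) : ∃ l, M i l ≠ 0 ∧ (M ^ k) l j ≠ 0 := by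
  rw [pow_succ', Matrix.mul_apply] at h
  obtain ⟨l, -, hl⟩ := Finset.exists_ne_zero_of_sum_ne_zero h
  exact ⟨l, left_ne_zero_of_mul hl, right_ne_zero_of_mul hl⟩

/-! ### The dichotomy from primitivity, and the finite case. -/

section Primitive

variable [Fintype V] [DecidableEq V]

theorem exists_path_from (G : LabelledGraph V E A) (hG : G.matrix.IsPrimitive) (i : V) :
    ∃ e, G.IsPath e ∧ G.init (e 0) = i := by
  -- A positive entry of a power with exponent at least `1` forces an edge out of `v`.
  have hstep : ∀ v, ∃ e, G.init e = v := fun v => by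
    obtain ⟨k, hk, hpos⟩ := hG.exists_pos_pow
    obtain ⟨m, rfl⟩ := Nat.exists_eq_succ_of_ne_zero hk.ne'
    obtain ⟨l, hl, -⟩ := exists_matrix_ne_zero_of_pow (hpos v v).ne'
    obtain ⟨e, he, -⟩ := G.exists_edge hl
    exact ⟨e, he⟩
  choose s hs using hstep
  exact ⟨fun n => Nat.rec (s i) (fun _ e => s (G.term e)) n, fun n => (hs _).symm, hs i⟩

/-- Prefixing an edge maps the values from its end injectively into the values from its start, so
uniqueness of the value travels forward along edges. -/
theorem subsingleton_valuesFrom_of_pow (G : LabelledGraph V E A) {β : ℝ} (hβ : 1 < β) (k : ℕ) :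
    ∀ {i j : V}, (G.matrix ^ k) i j ≠ 0 → (G.valuesFrom β i).Subsingleton →
      (G.valuesFrom β j).Subsingleton := by
  induction k with
  | zero =>
    intro i j hij hi
    have : i = j := by
      by_contra h
      simp [h] at hij
    exact this ▸ hi
  | succ k ih =>
    intro i j hij hi
    obtain ⟨l, hl, hlj⟩ := exists_matrix_ne_zero_of_pow hij
    refine ih hlj ?_
    obtain ⟨e₀, rfl, rfl⟩ := G.exists_edge hl
    rintro _ ⟨e, he, he0, rfl⟩ _ ⟨e', he', he0', rfl⟩
    have h := hi ⟨_, he.cons he0.symm, rfl, rfl⟩ ⟨_, he'.cons he0'.symm, rfl, rfl⟩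
    have hb : β ≠ 0 := (zero_lt_one.trans hβ).ne'
    rw [G.pathValue_eq hβ, G.pathValue_eq hβ (fun n => Nat.casesOn n e₀ e'),
      div_left_inj' hb] at h
    exact add_left_cancel h

theorem finite_range_phi_of_subsingleton (G : LabelledGraph V E A) (hG : G.matrix.IsPrimitive)
    {β : ℝ} (hβ : 1 < β) {i : V} (hi : (G.valuesFrom β i).Subsingleton) :
    (Set.range (G.phi β)).Finite := by
  obtain ⟨k, -, hpos⟩ := hG.exists_pos_pow
  rw [range_phi_eq_iUnion]
  exact Set.finite_iUnion fun j =>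
    (G.subsingleton_valuesFrom_of_pow hβ k (hpos i j).ne' hi).finite

theorem isPurelyAtomic_erdosMeasure [Nonempty V] (G : LabelledGraph V E A)
    (hG : G.matrix.IsPrimitive) {β : ℝ} (hβ : 1 < β) (hfin : (Set.range (G.phi β)).Finite) :
    IsPurelyAtomic (G.erdosMeasure hG β) := by
  have h0 : G.erdosMeasure hG β (Set.range (G.phi β))ᶜ = 0 := by
    rw [erdosMeasure, Measure.map_apply (G.measurable_phi hβ) hfin.measurableSet.compl]
    simp
  refine ⟨hfin.countable.mono fun x hx => ?_, ?_⟩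
  · by_contra hc
    exact (Set.mem_ofPred.1 hx).ne' (measure_mono_null (Set.singleton_subset_iff.2 hc) h0)
  · have h1 : G.erdosMeasure hG β
        (⋃ x ∈ {x ∈ Set.range (G.phi β) | G.erdosMeasure hG β {x} = 0}, {x}) = 0 :=
      (measure_biUnion_null_iff (hfin.subset fun x hx => hx.1).countable).2 fun x hx => hx.2
    -- A point that is not an atom lies outside the range, or is one of finitely many null points of
    -- it.
    refine measure_mono_null (fun x hx => ?_) (measure_union_null h0 h1)
    by_cases hxr : x ∈ Set.range (G.phi β)
    · right
      have hx0 : G.erdosMeasure hG β {x} = 0 := by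
        by_contra hne
        exact hx (pos_iff_ne_zero.2 hne)
      exact Set.mem_biUnion (show x ∈ {x ∈ Set.range (G.phi β) | G.erdosMeasure hG β {x} = 0}
        from ⟨hxr, hx0⟩) rfl
    · exact Or.inl hxr

end Primitive

end LabelledGraph

/-- A nonempty perfect set contains an injective image of the Cantor space. -/
theorem Perfect.not_countable_of_nonempty {C : Set ℝ} (hC : Perfect C) (hne : C.Nonempty) :
    ¬ C.Countable := by
  obtain ⟨f, hf, -, hinj⟩ := hC.exists_nat_bool_injection hne
  intro hc
  have := hc.to_subtype
  have h : Countable (ℕ → Bool) :=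
    Function.Injective.countable (f := fun u => (⟨f u, hf ⟨u, rfl⟩⟩ : C))
      fun u v huv => hinj (Subtype.ext_iff.1 huv)
  have h2 := Cardinal.mk_le_aleph0_iff.2 h
  rw [← Cardinal.power_def, Cardinal.mk_bool, Cardinal.mk_nat] at h2
  exact (Cardinal.cantor _).not_ge h2

namespace LabelledGraph

variable {V E : Type*} {A : Finset ℤ}

/-! ### Masses of words and their uniform contraction. -/

section Mass

variable [Fintype V]

/-- The total weight, seen from the vertex `i`, of the words `w` of length `n` for which the
inverse branch of `w` moves `x` into `[-R, R]`, where `R = expansionRadius A β`. -/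
noncomputable def wordMass (G : LabelledGraph V E A) (β lam : ℝ) (vR : V → ℝ) :
    ℕ → V → ℝ → ℝ
  | 0, i, x => if |x| ≤ expansionRadius A β then vR i else 0
  | n + 1, i, x => lam⁻¹ * ∑ j, ∑ a : A,
      G.transitionMatrix a i j * G.wordMass β lam vR n j (β * x - ((a : ℤ) : ℝ))

variable (G : LabelledGraph V E A) {β lam : ℝ} {vL vR : V → ℝ}

theorem wordMass_nonneg (hP : IsPerron G.matrix lam vL vR) (n : ℕ) :
    ∀ i x, 0 ≤ G.wordMass β lam vR n i x := by
  induction n with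
  | zero =>
    intro i x
    rw [wordMass]
    split_ifs
    exacts [(hP.vR_pos i).le, le_rfl]
  | succ n ih =>
    intro i x
    rw [wordMass]
    exact mul_nonneg (inv_nonneg.2 hP.lam_pos.le) (Finset.sum_nonneg fun j _ =>
      Finset.sum_nonneg fun a _ => mul_nonneg (G.transitionMatrix_nonneg _ _ _) (ih _ _))

/-- Without the cut-off at `R`, the recursion defining `wordMass` fixes `vR`; this is the total mass
against which losses are measured. -/
theorem perron_sum_eq (hP : IsPerron G.matrix lam vL vR) (i : V) :
    lam⁻¹ * ∑ j, ∑ a : A, G.transitionMatrix a i j * vR j = vR i := by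
  have h := congrFun hP.right_eigen i
  simp only [Matrix.mulVec, dotProduct, Pi.smul_apply, smul_eq_mul] at h
  simp_rw [← Finset.sum_mul, G.sum_transitionMatrix]
  rw [h, inv_mul_cancel_left₀ hP.lam_pos.ne']

theorem wordMass_le (hP : IsPerron G.matrix lam vL vR) (n : ℕ) :
    ∀ i x, G.wordMass β lam vR n i x ≤ vR i := by
  induction n with
  | zero =>
    intro i x
    rw [wordMass]
    split_ifs
    exacts [le_rfl, (hP.vR_pos i).le]
  | succ n ih =>
    intro i x
    rw [wordMass]
    conv_rhs => rw [← G.perron_sum_eq hP i]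
    refine mul_le_mul_of_nonneg_left ?_ (inv_nonneg.2 hP.lam_pos.le)
    exact Finset.sum_le_sum fun j _ => Finset.sum_le_sum fun a _ =>
      mul_le_mul_of_nonneg_left (ih _ _) (G.transitionMatrix_nonneg _ _ _)

/-- Once outside `[-R, R]`, a point never comes back: `|β x - a| ≥ β |x| - (β - 1) R > R`. -/
theorem wordMass_eq_zero (hβ : 1 < β) (n : ℕ) :
    ∀ i x, expansionRadius A β < |x| → G.wordMass β lam vR n i x = 0 := by
  induction n with
  | zero =>
    intro i x hx
    rw [wordMass, if_neg hx.not_ge]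
  | succ n ih =>
    intro i x hx
    rw [wordMass, Finset.sum_eq_zero, mul_zero]
    refine fun j _ => Finset.sum_eq_zero fun a _ => ?_
    rw [ih, mul_zero]
    have h1 := abs_letter_le hβ a
    have h2 := abs_sub_abs_le_abs_sub (β * x) ((a : ℤ) : ℝ)
    rw [abs_mul, abs_of_pos (zero_lt_one.trans hβ)] at h2
    nlinarith

/-- A path from `i` whose value is far from `x` lowers the mass at `x` by a fixed
amount depending only on the length of the words. -/
theorem wordMass_le_sub (hβ : 1 < β) (hP : IsPerron G.matrix lam vL vR) {c : ℝ}
    (hc : ∀ i, c ≤ vR i) (n : ℕ) :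
    ∀ (e : ℕ → E) (x : ℝ), G.IsPath e →
      2 * expansionRadius A β < β ^ n * |x - G.pathValue β e| →
      G.wordMass β lam vR n (G.init (e 0)) x ≤ vR (G.init (e 0)) - (lam⁻¹) ^ n * c := by
  classical
  have hb : 0 < β := zero_lt_one.trans hβ
  have hl : 0 ≤ lam⁻¹ := inv_nonneg.2 hP.lam_pos.le
  induction n with
  | zero =>
    intro e x _ hx
    have h1 := abs_expansionValue_le hβ fun n => G.label (e n)
    have h2 := abs_sub x (G.pathValue β e)
    simp only [pathValue] at *
    -- The path value has modulus at most `R` and is more than `2R` away from `x`, so `|x| > R`.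
    rw [wordMass, if_neg (by linarith)]
    have := hc (G.init (e 0))
    linarith
  | succ n ih =>
    intro e x he hx
    set a := G.label (e 0) with ha
    -- An inverse step along the path's own first edge multiplies the distance to the path value by
    -- `β`.
    have htail : β * x - ((a : ℤ) : ℝ) - (G.pathValue β fun n => e (n + 1)) =
        β * (x - G.pathValue β e) := by
      rw [G.pathValue_eq hβ e]
      field_simp
      ring
    have hM : G.transitionMatrix a (G.init (e 0)) (G.init (e 1)) = 1 := by
      simp only [transitionMatrix, Matrix.of_apply]
      exact if_pos ⟨e 0, rfl, he 0, rfl⟩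
    have hrec := ih _ (β * x - ((a : ℤ) : ℝ)) he.tail (by
      rw [htail, abs_mul, abs_of_pos hb, ← mul_assoc, ← pow_succ]
      exact hx)
    rw [wordMass]
    conv_rhs => rw [← G.perron_sum_eq hP]
    rw [pow_succ', mul_assoc, ← mul_sub]
    refine mul_le_mul_of_nonneg_left ?_ hl
    rw [le_sub_iff_add_le]
    -- The loss is charged to the single term given by the first edge of the path; every other term
    -- gets the trivial bound.
    have hterm : ∀ j, ∀ b : A, G.transitionMatrix b (G.init (e 0)) j *
          G.wordMass β lam vR n j (β * x - ((b : ℤ) : ℝ)) +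
          (if j = G.init (e 1) then if b = a then lam⁻¹ ^ n * c else 0 else 0) ≤
        G.transitionMatrix b (G.init (e 0)) j * vR j := by
      intro j b
      have hgen := mul_le_mul_of_nonneg_left (G.wordMass_le (β := β) hP n j
        (β * x - ((b : ℤ) : ℝ))) (G.transitionMatrix_nonneg b (G.init (e 0)) j)
      split_ifs with h1 h2
      · rw [h1, h2, hM]
        simp only [one_mul]
        simp only [zero_add] at hrec
        linarith
      · simpa using hgen
      · simpa using hgen
    have hsum := Finset.sum_le_sum fun j (_ : j ∈ Finset.univ) =>
      Finset.sum_le_sum fun b (_ : b ∈ Finset.univ) => hterm j b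
    simp_rw [Finset.sum_add_distrib] at hsum
    simpa using hsum

/-- After `n` letters, the remaining `N` letters cost a factor `q` at a point still in `[-R, R]`,
and carry no mass at a point already outside. -/
theorem wordMass_add_le (hβ : 1 < β) (hP : IsPerron G.matrix lam vL vR) {N : ℕ} {q : ℝ}
    (hq : ∀ i x, G.wordMass β lam vR N i x ≤ q * vR i) (n : ℕ) :
    ∀ i x, G.wordMass β lam vR (n + N) i x ≤ q * G.wordMass β lam vR n i x := by
  induction n with
  | zero =>
    intro i x
    rw [zero_add]
    by_cases hx : |x| ≤ expansionRadius A β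
    · simpa [wordMass, hx] using hq i x
    · rw [G.wordMass_eq_zero hβ N i x (not_le.1 hx)]
      simp [wordMass, hx]
  | succ n ih =>
    intro i x
    rw [Nat.add_right_comm, wordMass, wordMass, mul_left_comm]
    refine mul_le_mul_of_nonneg_left ?_ (inv_nonneg.2 hP.lam_pos.le)
    simp_rw [Finset.mul_sum]
    refine Finset.sum_le_sum fun j _ => Finset.sum_le_sum fun a _ => ?_
    rw [mul_left_comm]
    exact mul_le_mul_of_nonneg_left (ih _ _) (G.transitionMatrix_nonneg _ _ _)

theorem wordMass_mul_le (hβ : 1 < β) (hP : IsPerron G.matrix lam vL vR) {N : ℕ} {q : ℝ}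
    (hq0 : 0 ≤ q) (hq : ∀ i x, G.wordMass β lam vR N i x ≤ q * vR i) (k : ℕ) (i : V) (x : ℝ) :
    G.wordMass β lam vR (k * N) i x ≤ q ^ k * vR i := by
  induction k with
  | zero => simpa using G.wordMass_le hP 0 i x
  | succ k ih =>
    rw [Nat.succ_mul, pow_succ', mul_assoc]
    exact (G.wordMass_add_le hβ hP hq _ i x).trans (mul_le_mul_of_nonneg_left ih hq0)

/-- If no set of values of paths from a vertex is a singleton, the masses contract uniformly. -/
theorem exists_wordMass_contraction [Nonempty V] (hβ : 1 < β)
    (hP : IsPerron G.matrix lam vL vR) (hnt : ∀ i, (G.valuesFrom β i).Nontrivial) :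
    ∃ (N : ℕ) (q : ℝ), 0 ≤ q ∧ q < 1 ∧ ∀ i x, G.wordMass β lam vR N i x ≤ q * vR i := by
  have hb : 0 < β := zero_lt_one.trans hβ
  have hpair : ∀ i, ∃ p p' : ℕ → E, (G.IsPath p ∧ G.init (p 0) = i) ∧
      (G.IsPath p' ∧ G.init (p' 0) = i) ∧ G.pathValue β p ≠ G.pathValue β p' := fun i => by
    obtain ⟨_, ⟨p, hp, hp0, rfl⟩, _, ⟨p', hp', hp0', rfl⟩, hne⟩ := hnt i
    exact ⟨p, p', ⟨hp, hp0⟩, ⟨hp', hp0'⟩, hne⟩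
  choose p p' hp hp' hne using hpair
  -- Half the gap: every `x` is at least that far from one of the two values.
  have hN : ∀ i, ∃ N : ℕ, 2 * expansionRadius A β <
      β ^ N * (|G.pathValue β (p i) - G.pathValue β (p' i)| / 2) := fun i => by
    have hpos : 0 < |G.pathValue β (p i) - G.pathValue β (p' i)| / 2 :=
      half_pos (abs_pos.2 (sub_ne_zero.2 (hne i)))
    obtain ⟨N, hN⟩ := pow_unbounded_of_one_lt (2 * expansionRadius A β / _) hβ
    exact ⟨N, (div_lt_iff₀ hpos).1 hN⟩
  choose N' hN' using hN
  -- One length serves all vertices, since there are finitely many.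
  obtain ⟨N, hN⟩ := (Set.finite_range N').bddAbove
  obtain ⟨i₀, hi₀⟩ := Finite.exists_min vR
  obtain ⟨i₁, hi₁⟩ := Finite.exists_max vR
  set δ := (lam⁻¹) ^ N * vR i₀ with hδ
  have hδ0 : 0 < δ := mul_pos (pow_pos (inv_pos.2 hP.lam_pos) _) (hP.vR_pos i₀)
  have hmain : ∀ i x, G.wordMass β lam vR N i x ≤ vR i - δ := by
    intro i x
    have hbig : 2 * expansionRadius A β <
        β ^ N * (|G.pathValue β (p i) - G.pathValue β (p' i)| / 2) :=
      (hN' i).trans_le (mul_le_mul_of_nonneg_right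
        (pow_le_pow_right₀ hβ.le (hN ⟨i, rfl⟩)) (by positivity))
    have htri := abs_sub_le (G.pathValue β (p i)) x (G.pathValue β (p' i))
    rw [abs_sub_comm _ x] at htri
    have hpow : 0 < β ^ N := pow_pos hb _
    rcases le_total (|G.pathValue β (p i) - G.pathValue β (p' i)| / 2)
      |x - G.pathValue β (p i)| with h | h
    · have := G.wordMass_le_sub hβ hP hi₀ N (p i) x (hp i).1
        (hbig.trans_le (mul_le_mul_of_nonneg_left h hpow.le))
      rwa [(hp i).2] at this
    · have h' : |G.pathValue β (p i) - G.pathValue β (p' i)| / 2 ≤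
        |x - G.pathValue β (p' i)| := by linarith
      have := G.wordMass_le_sub hβ hP hi₀ N (p' i) x (hp' i).1
        (hbig.trans_le (mul_le_mul_of_nonneg_left h' hpow.le))
      rwa [(hp' i).2] at this
  have hv := hP.vR_pos i₁
  -- Dividing by the largest entry of `vR` turns the uniform loss `δ` into a relative one; `q ≥ 0`
  -- because the mass at `i₁` is nonnegative and at most `vR i₁ - δ`.
  refine ⟨N, 1 - δ / vR i₁, ?_, by linarith [div_pos hδ0 hv], fun i x => (hmain i x).trans ?_⟩
  · rw [sub_nonneg, div_le_one hv]
    have h1 := G.wordMass_nonneg (β := β) hP N i₁ 0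
    have h2 := hmain i₁ 0
    linarith
  · rw [sub_mul, one_mul]
    have : δ / vR i₁ * vR i ≤ δ / vR i₁ * vR i₁ :=
      mul_le_mul_of_nonneg_left (hi₁ i) (div_pos hδ0 hv).le
    rw [div_mul_cancel₀ _ hv.ne'] at this
    linarith

end Mass

/-! ### From masses to the measure of a point. -/

/-- The image of `x` under the inverse branch of the word `w`. -/
noncomputable def inverseBranch (β : ℝ) : (n : ℕ) → (Fin n → A) → ℝ → ℝ
  | 0, _, x => x
  | n + 1, w, x => inverseBranch β n (fun i => w i.succ) (β * x - ((w 0 : ℤ) : ℝ))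

/-- Following its own digits, a value is carried to the value of the tail, hence stays in `[-R, R]`.
-/
theorem inverseBranch_expansionValue {β : ℝ} (hβ : 1 < β) (n : ℕ) :
    ∀ u : ℕ → A, inverseBranch β n (fun i => u i) (expansionValue β u) =
      expansionValue β fun k => u (k + n) := by
  induction n with
  | zero => intro u; rfl
  | succ n ih =>
    intro u
    have h := ih fun k => u (k + 1)
    rw [expansionValue_tail hβ] at h
    rw [inverseBranch]
    refine Eq.trans ?_ (h.trans ?_)
    · rfl
    · simp only [Nat.add_assoc]

section Cylinders

variable [Fintype V] [DecidableEq V]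

theorem wordMatrix_cons (G : LabelledGraph V E A) {k : ℕ} (a : A) (w : Fin k → A) :
    G.wordMatrix (Fin.cons a w : Fin (k + 1) → A) = G.transitionMatrix a * G.wordMatrix w := by
  simp [wordMatrix, List.ofFn_succ]

-- Unfolds the recursion by splitting off the first letter, so that masses become sums of cylinder
-- weights before pairing with `vL`.
open Classical in
theorem sum_wordMatrix_eq_wordMass (G : LabelledGraph V E A) (β lam : ℝ) (vR : V → ℝ) (n : ℕ) :
    ∀ i x, ∑ w : Fin n → A, (if |inverseBranch β n w x| ≤ expansionRadius A β then
      (lam ^ n)⁻¹ * (G.wordMatrix w).mulVec vR i else 0) = G.wordMass β lam vR n i x := by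
  induction n with
  | zero =>
    intro i x
    simp [wordMass, inverseBranch, wordMatrix]
  | succ n ih =>
    intro i x
    rw [wordMass, ← (Fin.consEquiv fun _ => (A : Type)).sum_comp, Fintype.sum_prod_type,
      Finset.sum_comm (s := (Finset.univ : Finset V)), Finset.mul_sum]
    refine Finset.sum_congr rfl fun a _ => ?_
    simp_rw [← ih, Finset.mul_sum]
    rw [Finset.sum_comm]
    refine Finset.sum_congr rfl fun w _ => ?_
    have hw : inverseBranch β (n + 1) (Fin.consEquiv (fun _ => (A : Type)) (a, w)) x =
        inverseBranch β n w (β * x - ((a : ℤ) : ℝ)) := by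
      simp [inverseBranch]
    have hm : G.wordMatrix (Fin.consEquiv (fun _ => (A : Type)) (a, w)) =
        G.transitionMatrix a * G.wordMatrix w := G.wordMatrix_cons a w
    simp only [hw, hm, ← Matrix.mulVec_mulVec]
    split_ifs
    · rw [Matrix.mulVec, dotProduct, Finset.mul_sum]
      refine Finset.sum_congr rfl fun j _ => ?_
      rw [pow_succ, mul_inv]
      ring
    · simp

theorem wordMatrix_nonneg (G : LabelledGraph V E A) (n : ℕ) :
    ∀ (w : Fin n → A) (i j : V), 0 ≤ G.wordMatrix w i j := by
  induction n with
  | zero =>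
    intro w i j
    simp only [wordMatrix, List.ofFn_zero, List.prod_nil, Matrix.one_apply]
    split_ifs <;> norm_num
  | succ n ih =>
    intro w i j
    rw [wordMatrix_snoc, Matrix.mul_apply]
    exact Finset.sum_nonneg fun l _ => mul_nonneg (ih _ _ _) (G.transitionMatrix_nonneg _ _ _)

/-- The fibre of `phi` over `x` is covered by the cylinders of those words whose inverse branch
keeps `x` in `[-R, R]`. -/
theorem erdosMeasure_singleton_le [Nonempty V] (G : LabelledGraph V E A)
    (hG : G.matrix.IsPrimitive) {β lam : ℝ} {vL vR : V → ℝ} (hβ : 1 < β)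
    (hP : IsPerron G.matrix lam vL vR) (n : ℕ) (x : ℝ) :
    G.erdosMeasure hG β {x} ≤ ENNReal.ofReal (∑ i, vL i * G.wordMass β lam vR n i x) := by
  classical
  rw [erdosMeasure, Measure.map_apply (G.measurable_phi hβ) (measurableSet_singleton x)]
  have hnn : ∀ w : Fin n → A, 0 ≤ (lam ^ n)⁻¹ * dotProduct vL ((G.wordMatrix w).mulVec vR) := fun w =>
    mul_nonneg (inv_nonneg.2 (pow_nonneg hP.lam_pos.le n)) (Finset.sum_nonneg fun i _ =>
      mul_nonneg (hP.vL_pos i).le (Finset.sum_nonneg fun j _ =>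
        mul_nonneg (G.wordMatrix_nonneg n w i j) (hP.vR_pos j).le))
  calc G.parryMeasure hG (G.phi β ⁻¹' {x})
      ≤ G.parryMeasure hG (⋃ w ∈ Finset.univ.filter fun w : Fin n → A =>
          |inverseBranch β n w x| ≤ expansionRadius A β, G.cylinder w) := by
        refine measure_mono fun u hu => ?_
        have hu : expansionValue β u.1 = x := hu
        refine Set.mem_biUnion (x := fun i : Fin n => u.1 i) ?_ fun i => rfl
        simp only [Finset.coe_filter, Finset.mem_univ, true_and, Set.mem_ofPred]
        rw [← hu, inverseBranch_expansionValue hβ]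
        exact abs_expansionValue_le hβ _
    _ ≤ ∑ w ∈ Finset.univ.filter fun w : Fin n → A =>
          |inverseBranch β n w x| ≤ expansionRadius A β, G.parryMeasure hG (G.cylinder w) :=
        measure_biUnion_finset_le _ _
    _ = ENNReal.ofReal (∑ i, vL i * G.wordMass β lam vR n i x) := by
        simp_rw [G.parryMeasure_cylinder hG hP]
        rw [← ENNReal.ofReal_sum_of_nonneg fun w _ => hnn w]
        congr 1
        simp_rw [← G.sum_wordMatrix_eq_wordMass, Finset.sum_filter, Finset.mul_sum]
        rw [Finset.sum_comm]
        refine Finset.sum_congr rfl fun w _ => ?_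
        split_ifs
        · simp only [dotProduct, Finset.mul_sum]
          exact Finset.sum_congr rfl fun i _ => by ring
        · simp

theorem erdosMeasure_singleton_eq_zero [Nonempty V] (G : LabelledGraph V E A)
    (hG : G.matrix.IsPrimitive) {β : ℝ} (hβ : 1 < β)
    (hnt : ∀ i, (G.valuesFrom β i).Nontrivial) (x : ℝ) : G.erdosMeasure hG β {x} = 0 := by
  obtain ⟨lam, vL, vR, hP⟩ := exists_isPerron hG
  obtain ⟨N, q, hq0, hq1, hq⟩ := G.exists_wordMass_contraction hβ hP hnt
  have hbound : ∀ k : ℕ, G.erdosMeasure hG β {x} ≤ ENNReal.ofReal (q ^ k) := fun k => by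
    refine (G.erdosMeasure_singleton_le hG hβ hP (k * N) x).trans (ENNReal.ofReal_le_ofReal ?_)
    calc ∑ i, vL i * G.wordMass β lam vR (k * N) i x
        ≤ ∑ i, vL i * (q ^ k * vR i) := Finset.sum_le_sum fun i _ =>
          mul_le_mul_of_nonneg_left (G.wordMass_mul_le hβ hP hq0 hq k i x) (hP.vL_pos i).le
      _ = q ^ k * dotProduct vL vR := by
          rw [dotProduct, Finset.mul_sum]
          exact Finset.sum_congr rfl fun i _ => by ring
      _ = q ^ k := by rw [hP.normalised, mul_one]
  have hlim : Filter.Tendsto (fun k : ℕ => ENNReal.ofReal (q ^ k)) Filter.atTop (nhds 0) := by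
    simpa using ENNReal.tendsto_ofReal (tendsto_pow_atTop_nhds_zero_of_lt_one hq0 hq1)
  exact le_antisymm (ge_of_tendsto' hlim hbound) zero_le

end Cylinders

end LabelledGraph

/-! ### Assembly of the dichotomy. -/

theorem mainTheorem2 {V E : Type*} [Fintype V] [DecidableEq V] [Nonempty V] [Finite E]
    {A : Finset ℤ} (G : LabelledGraph V E A) (hG : G.matrix.IsPrimitive)
    (β : ℝ) (hβ : IsPisot β) :
    ((Set.range (G.phi β)).Finite ∨ Perfect (Set.range (G.phi β))) ∧
    (Perfect (Set.range (G.phi β)) → ¬ (Set.range (G.phi β)).Countable) ∧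
    ((Set.range (G.phi β)).Finite → IsPurelyAtomic (G.erdosMeasure hG β)) ∧
    (Perfect (Set.range (G.phi β)) → ∀ x : ℝ, G.erdosMeasure hG β {x} = 0) := by
  have hb : 1 < β := hβ.1
  have hne : (Set.range (G.phi β)).Nonempty := by
    obtain ⟨e, he, -⟩ := G.exists_path_from hG (Classical.arbitrary V)
    rw [G.range_phi]
    exact ⟨_, e, he, rfl⟩
  have hnt : ¬ (Set.range (G.phi β)).Finite → ∀ i, (G.valuesFrom β i).Nontrivial := fun h i =>
    Set.not_subsingleton_iff.1 fun hi => h (G.finite_range_phi_of_subsingleton hG hb hi)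
  refine ⟨?_, fun h => h.not_countable_of_nonempty hne,
    G.isPurelyAtomic_erdosMeasure hG hb, fun h => ?_⟩
  · exact or_iff_not_imp_left.2 fun h => G.perfect_range_phi hb (hnt h)
  -- A nonempty perfect range is uncountable, hence infinite, so every vertex has two values.
  · exact G.erdosMeasure_singleton_eq_zero hG hb
      (hnt fun hf => h.not_countable_of_nonempty hne hf.countable)
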